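/- For $n\ge 1$ let $O^{*}(n)$ be the weighted number of partitions of $n$ into odd parts such that (i) if a number appears as a part, then all smaller positive odd numbers appear as parts as well, and (ii) the largest part appears an odd number of times, where a partition is counted with weight $-1$ if its largest part is congruent to $1 \pmod 4$ and with weight $+1$ if its largest part is congruent to $3 \pmod 4$. Let $L=\mathbb{Q}(\sqrt{2})$, let $O_L$ be its ring of integers, and for an ideal $\mathfrak{a}\subset O_L$ let $N(\mathfrak{a})$ be its norm. Then, as formal Laurent series in $q$ with integer coefficients (both infinite sums being convergent coefficientwise), $$2q^{-1}\sum_{n\ge1}O^{*}(n)q^{8n}=\sum_{\substack{\mathfrak{a}\subset O_L \\ N(\mathfrak{a})\equiv-1\ (\mathrm{mod}\ 8)}}(-1)^{\frac{N(\mathfrak{a})+1}{8}}q^{N(\mathfrak{a})}.$$ -/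

import Mathlib

open scoped IntermediateField NumberField PowerSeries LaurentSeries PowerSeries.WithPiTopology

/-- The partitions `p` into odd parts such that, whenever a number appears as a part, every smaller
(positive) odd number appears as a part as well, and such that the largest part appears an odd
number of times. -/
def IsOStarPartition {n : ℕ} (p : n.Partition) : Prop :=
  (∀ i ∈ p.parts, Odd i) ∧
  (∀ i ∈ p.parts, ∀ j < i, Odd j → j ∈ p.parts) ∧
  Odd (p.parts.count p.parts.sup)

/-- `-1` if the largest part is congruent to `1` mod `4`, and `+1` otherwise, i.e. if the largest
part is congruent to `3` mod `4` when all the parts are odd. -/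
def oWeight {n : ℕ} (p : n.Partition) : ℤ :=
  if p.parts.sup % 4 = 1 then -1 else 1

open Classical in
/-- The number `O*(n)`: the partitions of `n` above, counted with their weights. -/
noncomputable def OStar (n : ℕ) : ℤ :=
  ∑ p : n.Partition with IsOStarPartition p, oWeight p

/-- The field `ℚ(√2)`. -/
noncomputable abbrev QSqrtTwo : IntermediateField ℚ ℝ := ℚ⟮√(2 : ℝ)⟯

instance : NumberField QSqrtTwo where
  to_charZero := inferInstance
  to_finiteDimensional := by
    refine IntermediateField.adjoin.finiteDimensional ?_
    refine ⟨Polynomial.X ^ 2 - Polynomial.C 2, Polynomial.monic_X_pow_sub_C 2 two_ne_zero, ?_⟩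
    simp

/-- The ideals of the ring of integers of `ℚ(√2)` whose norm is congruent to `-1` mod `8`. -/
abbrev NormNegOneIdeal : Type :=
  {a : Ideal (𝓞 QSqrtTwo) // (Ideal.absNorm a : ℤ) ≡ -1 [ZMOD 8]}

open PowerSeries in
/-- The inverse of `1 - X ^ d` for `d ≠ 0`. -/
noncomputable def geom (d : ℕ) : ℤ⟦X⟧ := invOfUnit (1 - X ^ d) 1

open PowerSeries in
lemma one_sub_mul_geom {d : ℕ} (hd : d ≠ 0) : (1 - X ^ d) * geom d = 1 :=
  mul_invOfUnit _ _ (by simp [hd])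

/-- The finite product `(1 - X ^ 2) (1 - X ^ 4) ⋯ (1 - X ^ (2 n))`. -/
noncomputable def evenPoch (n : ℕ) : ℤ⟦X⟧ :=
  ∏ i ∈ Finset.range n, (1 - PowerSeries.X ^ (2 * (i + 1)))

/-- The inverse of `evenPoch n`. -/
noncomputable def evenPochInv (n : ℕ) : ℤ⟦X⟧ :=
  ∏ i ∈ Finset.range n, geom (2 * (i + 1))

@[simp] lemma evenPoch_zero : evenPoch 0 = 1 := rfl

@[simp] lemma evenPochInv_zero : evenPochInv 0 = 1 := rfl

lemma evenPoch_succ (n : ℕ) :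
    evenPoch (n + 1) = evenPoch n * (1 - PowerSeries.X ^ (2 * (n + 1))) :=
  Finset.prod_range_succ _ _

lemma evenPochInv_eq (n : ℕ) :
    evenPochInv n = (1 - PowerSeries.X ^ (2 * (n + 1))) * evenPochInv (n + 1) := by
  rw [evenPochInv, evenPochInv, Finset.prod_range_succ, mul_left_comm,
    one_sub_mul_geom (by omega), mul_one]

lemma evenPoch_mul_evenPochInv (n : ℕ) : evenPoch n * evenPochInv n = 1 := by
  rw [evenPoch, evenPochInv, ← Finset.prod_mul_distrib]
  exact Finset.prod_eq_one fun i _ => one_sub_mul_geom (by omega)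

/-- A sequence of power series whose `m`-th term is divisible by `X ^ m` is summable. -/
lemma summable_of_X_pow_dvd {f : ℕ → ℤ⟦X⟧} (h : ∀ m, PowerSeries.X ^ m ∣ f m) : Summable f := by
  rw [PowerSeries.WithPiTopology.summable_iff_summable_coeff]
  refine fun d => summable_of_hasFiniteSupport ((Set.finite_Iic d).subset fun m hm => ?_)
  by_contra hlt
  exact hm (PowerSeries.X_pow_dvd_iff.mp (h m) d (by simpa using hlt))

lemma HasSum.of_eq {ι M : Type*} [AddCommMonoid M] [TopologicalSpace M] {f g : ι → M} {a b : M}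
    (h : HasSum g b) (hf : ∀ i, f i = g i) (ha : a = b) : HasSum f a := by
  rwa [funext hf, ha]

lemma hasSum_sub_succ {f : ℕ → ℤ⟦X⟧} (h : ∀ m, PowerSeries.X ^ m ∣ f m) :
    HasSum (fun m => f m - f (m + 1)) (f 0) := by
  have hs := (summable_of_X_pow_dvd h).hasSum
  have hs' := (hasSum_nat_add_iff' 1).mpr hs
  simpa using hs.sub hs'

/-- The terms of the `q`-analogue (in base `X ^ 2`) of Gauss' limiting summation. -/
noncomputable def gaussTerm (r c m : ℕ) : ℤ⟦X⟧ :=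
  (-1) ^ m * PowerSeries.X ^ (m * (m + 1) + 2 * c * m) * evenPoch (r + m) * evenPochInv m *
    evenPochInv (r + 1 + c + m)

lemma X_pow_dvd_of_le {e m : ℕ} (h : m ≤ e) (s a b c : ℤ⟦X⟧) :
    PowerSeries.X ^ m ∣ s * PowerSeries.X ^ e * a * b * c :=
  Dvd.dvd.mul_right (Dvd.dvd.mul_right (Dvd.dvd.mul_right
    (Dvd.dvd.mul_left (pow_dvd_pow _ h) _) _) _) _

lemma hasSum_gaussTerm (r : ℕ) : ∀ c : ℕ, HasSum (gaussTerm r c) (evenPoch r * evenPochInv c) := by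
  induction r with
  | zero =>
    intro c
    have key := hasSum_sub_succ (f := fun m => (-1) ^ m *
      PowerSeries.X ^ (m * (m + 1) + 2 * c * m) * evenPochInv (c + m) * 1 * 1)
      (fun m => X_pow_dvd_of_le (by nlinarith [Nat.zero_le (c * m)]) _ _ _ _)
    convert key using 1
    · funext m
      have h1 := evenPoch_mul_evenPochInv m
      have e1 : 0 + 1 + c + m = c + m + 1 := by ring
      rw [gaussTerm, e1, evenPochInv_eq (c + m), ← add_assoc c m 1, zero_add]
      linear_combination ((-1) ^ m * PowerSeries.X ^ (m * (m + 1) + 2 * c * m) *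
        evenPochInv (c + m + 1)) * h1
    · simp
  | succ r ih =>
    intro c
    have key := hasSum_sub_succ (f := fun m => (-1) ^ m *
      PowerSeries.X ^ (m * (m + 1) + 2 * c * m) * evenPoch (r + m) *
        ((1 - PowerSeries.X ^ (2 * m)) * evenPochInv m) * evenPochInv (r + 1 + c + m))
      (fun m => X_pow_dvd_of_le (by nlinarith [Nat.zero_le (c * m)]) _ _ _ _)
    have h2 := ((ih (c + 1)).mul_left ((1 - PowerSeries.X ^ (2 * (r + 1))) *
      (1 - PowerSeries.X ^ (2 * (c + 1))))).add key
    refine h2.of_eq (fun m => ?_) ?_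
    · have e1 : r + 1 + 1 + c + m = r + 1 + c + m + 1 := by ring
      have e2 : r + 1 + (c + 1) + m = r + 1 + c + m + 1 := by ring
      have e3 : r + 1 + m = r + m + 1 := by ring
      simp only [gaussTerm]
      rw [e1, e2, e3, ← add_assoc r m 1, evenPochInv_eq (r + 1 + c + m), evenPoch_succ,
        ← add_assoc (r + 1 + c) m 1, evenPochInv_eq m]
      ring
    · rw [evenPoch_succ, evenPochInv_eq c]
      simp
      ring

/-- The finite Rogers–Szegő sum (in base `X ^ 2`) at `X`. -/
noncomputable def szegoSum (M : ℕ) : ℤ⟦X⟧ :=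
  ∑ j ∈ Finset.range (M + 1), PowerSeries.X ^ j * evenPochInv j * evenPochInv (M - j)

lemma one_add_X_pow_ne_zero {d : ℕ} (hd : d ≠ 0) : (1 + PowerSeries.X ^ d : ℤ⟦X⟧) ≠ 0 := by
  intro h
  simpa [hd] using congrArg PowerSeries.constantCoeff h

lemma szegoSum_succ (M : ℕ) :
    szegoSum (M + 1) * (1 - PowerSeries.X ^ (M + 1)) = szegoSum M := by
  refine mul_right_cancel₀ (one_add_X_pow_ne_zero M.succ_ne_zero) ?_
  have h1 : ∑ j ∈ Finset.range (M + 2), PowerSeries.X ^ j * evenPochInv j *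
      evenPochInv (M + 1 - j) * (1 - PowerSeries.X ^ (2 * (M + 1 - j))) = szegoSum M := by
    rw [Finset.sum_range_succ, Nat.sub_self]
    simp only [mul_zero, pow_zero, sub_self, add_zero, szegoSum]
    refine Finset.sum_congr rfl fun j hj => ?_
    have : M + 1 - j = M - j + 1 := by grind
    rw [this, evenPochInv_eq (M - j)]
    ring
  have h2 : ∑ j ∈ Finset.range (M + 2), PowerSeries.X ^ j * evenPochInv j *
      evenPochInv (M + 1 - j) * (PowerSeries.X ^ (2 * (M + 1 - j)) * (1 - PowerSeries.X ^ (2 * j)))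
      = PowerSeries.X ^ (M + 1) * szegoSum M := by
    rw [Finset.sum_range_succ', szegoSum, ← Finset.sum_range_reflect, Finset.mul_sum]
    simp only [mul_zero, pow_zero, sub_self, add_zero]
    refine Finset.sum_congr rfl fun j hj => ?_
    have hj' : j ≤ M := by grind
    obtain ⟨l, rfl⟩ := Nat.exists_eq_add_of_le hj'
    have e1 : j + l + 1 - 1 - j = l := by omega
    have e2 : j + l + 1 - (l + 1) = j := by omega
    have e3 : j + l - j = l := by omega
    rw [e1, e2, e3, evenPochInv_eq l]
    ring
  rw [mul_assoc]
  conv_lhs => rw [szegoSum, Finset.sum_mul]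
  rw [Nat.succ_eq_add_one, mul_one_add (szegoSum M), mul_comm (szegoSum M) (PowerSeries.X ^ _), ← h2, ← h1,
    ← Finset.sum_add_distrib]
  refine Finset.sum_congr rfl fun j hj => ?_
  have hj' : j ≤ M + 1 := by grind
  have e : (PowerSeries.X : ℤ⟦X⟧) ^ (2 * (M + 1 - j)) * PowerSeries.X ^ (2 * j) =
      PowerSeries.X ^ (M + 1) * PowerSeries.X ^ (M + 1) := by
    rw [← pow_add, ← pow_add]; congr 1; omega
  linear_combination (PowerSeries.X ^ j * evenPochInv j * evenPochInv (M + 1 - j)) * e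

lemma szegoSum_mul_prod (M : ℕ) :
    szegoSum M * ∏ i ∈ Finset.range M, (1 - PowerSeries.X ^ (i + 1)) = 1 := by
  induction M with
  | zero => simp [szegoSum]
  | succ M ih => rw [Finset.prod_range_succ, mul_left_comm, szegoSum_succ, mul_comm, ih]

/-- The finite product `(1 - X) (1 - X ^ 3) ⋯ (1 - X ^ (2 n - 1))`. -/
noncomputable def oddPoch (n : ℕ) : ℤ⟦X⟧ :=
  ∏ i ∈ Finset.range n, (1 - PowerSeries.X ^ (2 * i + 1))

lemma oddPoch_succ (n : ℕ) :
    oddPoch (n + 1) = oddPoch n * (1 - PowerSeries.X ^ (2 * n + 1)) :=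
  Finset.prod_range_succ _ _

lemma prod_one_sub_X_pow_eq (n : ℕ) :
    ∏ i ∈ Finset.range (2 * n + 1), (1 - PowerSeries.X ^ (i + 1) : ℤ⟦X⟧) =
      evenPoch n * oddPoch (n + 1) := by
  induction n with
  | zero => simp [oddPoch]
  | succ n ih =>
    rw [show 2 * (n + 1) + 1 = 2 * n + 1 + 1 + 1 by ring, Finset.prod_range_succ,
      Finset.prod_range_succ, ih, evenPoch_succ, oddPoch_succ (n + 1)]
    ring

/-- The summand of the triple series that interpolates between the generating function of
`OStar` and an indefinite theta series. -/
noncomputable def tripleTerm (k a m : ℕ) : ℤ⟦X⟧ :=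
  (-1) ^ (k + 1 + a + m) *
    PowerSeries.X ^ ((k + 1 + a + m) ^ 2 + (a ^ 2 + 2 * k * a + a + m)) *
    (1 - PowerSeries.X ^ (4 * (k + 1 + a))) * evenPoch (k + a + m) * evenPochInv m *
    evenPochInv (2 * (k + 1 + a) + m)

/-- The exponent `n (n - 1) / 2 - k (k + 1)` with `n = 2 (k + 1 + a)`. -/
def thetaExp (k a : ℕ) : ℕ := (k + 1 + a) ^ 2 + (a ^ 2 + 2 * k * a + a)

lemma hasSum_tripleTerm (k a : ℕ) : HasSum (tripleTerm k a)
    ((-1) ^ (k + 1 + a) * (PowerSeries.X ^ thetaExp k a +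
      PowerSeries.X ^ (thetaExp k a + 2 * (k + 1 + a)))) := by
  have h := (hasSum_gaussTerm (k + a) (k + a + 1)).mul_left ((-1) ^ (k + 1 + a) *
    PowerSeries.X ^ thetaExp k a * (1 - PowerSeries.X ^ (4 * (k + 1 + a))))
  refine h.of_eq (fun m => ?_) ?_
  · rw [tripleTerm, gaussTerm, thetaExp,
      show k + a + 1 + (k + a + 1) + m = 2 * (k + 1 + a) + m by ring]
    ring
  · have h1 := evenPoch_mul_evenPochInv (k + a)
    rw [evenPochInv_eq (k + a)] at h1
    linear_combination (-(-1) ^ (k + 1 + a) * PowerSeries.X ^ thetaExp k a *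
      (1 + PowerSeries.X ^ (2 * (k + 1 + a)))) * h1

lemma sum_telescope (k L : ℕ) :
    (∑ a ∈ Finset.range (L + 1), PowerSeries.X ^ (a ^ 2 + 2 * k * a + a + (L - a)) *
      (1 - PowerSeries.X ^ (4 * (k + 1 + a))) * evenPochInv (L - a) *
      evenPochInv (2 * (k + 1 + a) + (L - a))) * (1 + PowerSeries.X ^ (2 * (k + L) + 1)) =
    (PowerSeries.X ^ L + PowerSeries.X ^ (L + 2 * k + 1)) * evenPochInv L *
      evenPochInv (L + 2 * k + 1) := by
  have key := Finset.sum_range_sub' (fun a => PowerSeries.X ^ (a ^ 2 + 2 * k * a + L) *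
    (1 + PowerSeries.X ^ (2 * k + 1 + 2 * a)) * ((1 - PowerSeries.X ^ (2 * (L + 1 - a))) *
      evenPochInv (L + 1 - a)) * evenPochInv (L + 2 * k + 1 + a)) (L + 1)
  simp only [Nat.sub_self, Nat.sub_zero, mul_zero, pow_zero, sub_self, zero_mul, sub_zero,
    ← evenPochInv_eq] at key
  rw [Finset.sum_mul]
  refine (Finset.sum_congr rfl fun a ha => ?_).trans (key.trans ?_)
  · obtain ⟨m, rfl⟩ := Nat.exists_eq_add_of_le (show a ≤ L by grind)
    have e1 : a + m - a = m := by omega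
    have e2 : a + m + 1 - a = m + 1 := by omega
    have e3 : a + m + 1 - (a + 1) = m := by omega
    have e4 : a + m + 2 * k + 1 + (a + 1) = a + m + 2 * k + 1 + a + 1 := by ring
    have e5 : 2 * (k + 1 + a) + m = a + m + 2 * k + 1 + a + 1 := by ring
    rw [e1, e2, e3, e4, e5, ← evenPochInv_eq m, evenPochInv_eq (a + m + 2 * k + 1 + a)]
    ring
  · ring

lemma szegoSum_odd (n : ℕ) :
    szegoSum (2 * n + 1) = ∑ k ∈ Finset.range (n + 1),
      (PowerSeries.X ^ (n - k) + PowerSeries.X ^ (n - k + 2 * k + 1)) * evenPochInv (n - k) *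
      evenPochInv (n - k + 2 * k + 1) := by
  rw [szegoSum, show 2 * n + 1 + 1 = (n + 1) + (n + 1) by ring, Finset.sum_range_add,
    ← Finset.sum_range_reflect, ← Finset.sum_add_distrib]
  refine Finset.sum_congr rfl fun k hk => ?_
  obtain ⟨l, rfl⟩ := Nat.exists_eq_add_of_le (show k ≤ n by grind)
  have e1 : k + l + 1 - 1 - k = l := by omega
  have e2 : 2 * (k + l) + 1 - l = l + 2 * k + 1 := by omega
  have e3 : k + l + 1 + k = l + 2 * k + 1 := by omega
  have e4 : 2 * (k + l) + 1 - (l + 2 * k + 1) = l := by omega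
  have e5 : k + l - k = l := by omega
  rw [e1, e2, e3, e4, e5]
  ring

lemma sum_tripleTerm_inner (k L : ℕ) :
    (∑ a ∈ Finset.range (L + 1), tripleTerm k a (L - a)) *
      (1 + PowerSeries.X ^ (2 * (k + L) + 1)) =
    (-1) ^ (k + L + 1) * PowerSeries.X ^ ((k + L + 1) ^ 2) * evenPoch (k + L) *
      ((PowerSeries.X ^ L + PowerSeries.X ^ (L + 2 * k + 1)) * evenPochInv L *
        evenPochInv (L + 2 * k + 1)) := by
  rw [← sum_telescope, ← mul_assoc, Finset.mul_sum]
  refine congrArg (· * _) (Finset.sum_congr rfl fun a ha => ?_)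
  obtain ⟨m, rfl⟩ := Nat.exists_eq_add_of_le (show a ≤ L by grind)
  rw [Nat.add_sub_cancel_left, tripleTerm, show k + 1 + a + m = k + (a + m) + 1 by ring,
    add_assoc k a m, pow_add PowerSeries.X ((k + (a + m) + 1) ^ 2)]
  simp only [mul_assoc, mul_left_comm]

/-- The sum of `tripleTerm k a m` over `k + a + m = n`. -/
noncomputable def tripleSum (n : ℕ) : ℤ⟦X⟧ :=
  ∑ k ∈ Finset.range (n + 1), ∑ a ∈ Finset.range (n - k + 1), tripleTerm k a (n - k - a)

lemma tripleSum_mul_one_add (n : ℕ) :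
    tripleSum n * (1 + PowerSeries.X ^ (2 * n + 1)) =
      (-1) ^ (n + 1) * PowerSeries.X ^ ((n + 1) ^ 2) * evenPoch n * szegoSum (2 * n + 1) := by
  rw [tripleSum, szegoSum_odd, Finset.sum_mul, Finset.mul_sum]
  refine Finset.sum_congr rfl fun k hk => ?_
  have h := sum_tripleTerm_inner k (n - k)
  rwa [Nat.add_sub_cancel' (by grind : k ≤ n)] at h

lemma tripleSum_mul (n : ℕ) :
    tripleSum n * ((1 - PowerSeries.X ^ (4 * n + 2)) * oddPoch n) =
      (-1) ^ (n + 1) * PowerSeries.X ^ ((n + 1) ^ 2) := by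
  have h1 := tripleSum_mul_one_add n
  have h2 := szegoSum_mul_prod (2 * n + 1)
  rw [prod_one_sub_X_pow_eq, oddPoch_succ] at h2
  rw [show 4 * n + 2 = (2 * n + 1) + (2 * n + 1) by ring, pow_add]
  generalize tripleSum n = S at *
  generalize (PowerSeries.X : ℤ⟦X⟧) ^ (2 * n + 1) = x at *
  generalize szegoSum (2 * n + 1) = R at *
  linear_combination (1 - x) * oddPoch n * h1 +
    (-1) ^ (n + 1) * PowerSeries.X ^ ((n + 1) ^ 2) * h2

open Classical in
lemma coeff_X_pow_mul_geom {i t : ℕ} (hi : i ≠ 0) (ht : t ≠ 0) (d : ℕ) :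
    PowerSeries.coeff d (PowerSeries.X ^ i * geom (t * i)) =
      if ∃ j, d = i * (1 + t * j) then 1 else 0 := by
  suffices h : PowerSeries.mk (fun d => if ∃ j, d = i * (1 + t * j) then (1 : ℤ) else 0) *
      (1 - PowerSeries.X ^ (t * i)) = PowerSeries.X ^ i by
    rw [← h, mul_assoc, one_sub_mul_geom (by positivity), mul_one, PowerSeries.coeff_mk]
  ext d
  rw [mul_sub, mul_one, map_sub, PowerSeries.coeff_mk, PowerSeries.coeff_mul_X_pow',
    PowerSeries.coeff_X_pow, PowerSeries.coeff_mk]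
  have hti : 0 < t * i := by positivity
  by_cases hd : d = i
  · subst hd
    rw [if_pos ⟨0, by simp⟩, if_pos rfl]
    split_ifs with h1 h2
    · obtain ⟨j, hj⟩ := h2
      have : d * (1 + t * j) = d + t * d * j := by ring
      have := Nat.zero_le (t * d * j)
      omega
    · rfl
    · rfl
  · rw [if_neg hd]
    have : (∃ j, d = i * (1 + t * j)) ↔ t * i ≤ d ∧ ∃ j, d - t * i = i * (1 + t * j) := by
      constructor
      · rintro ⟨j, rfl⟩
        cases j with
        | zero => simp at hd
        | succ j =>
          have : i * (1 + t * (j + 1)) = t * i + i * (1 + t * j) := by ring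
          exact ⟨by omega, j, by omega⟩
      · rintro ⟨hle, j, hj⟩
        have : i * (1 + t * (j + 1)) = t * i + i * (1 + t * j) := by ring
        exact ⟨j + 1, by omega⟩
    split_ifs <;> simp_all

open Classical in
/-- The partitions of `d` whose set of parts is `S` and in which each `i ∈ S` has a multiplicity
in `1 + t i ℕ` are counted by a product of geometric series. -/
lemma coeff_prod_geom (S : Finset ℕ) (hS : 0 ∉ S) (t : ℕ → ℕ) (ht : ∀ i, t i ≠ 0) (d : ℕ) :
    PowerSeries.coeff d (∏ i ∈ S, ((PowerSeries.X : ℤ⟦X⟧) ^ i * geom (t i * i))) =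
      (Finset.univ.filter fun p : d.Partition =>
        p.parts.toFinset = S ∧ ∀ i ∈ S, ∃ j, p.parts.count i = 1 + t i * j).card := by
  have hS' : ∀ i ∈ S, i ≠ 0 := fun i hi h => hS (h ▸ hi)
  rw [PowerSeries.coeff_prod]
  have h1 : ∀ g ∈ S.finsuppAntidiag d,
      ∏ i ∈ S, PowerSeries.coeff (g i) ((PowerSeries.X : ℤ⟦X⟧) ^ i * geom (t i * i)) =
        if ∀ i ∈ S, ∃ j, g i = i * (1 + t i * j) then (1 : ℤ) else 0 := by
    intro g _
    rw [Finset.prod_congr rfl fun i hi => coeff_X_pow_mul_geom (hS' i hi) (ht i) (g i),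
      Finset.prod_ite_zero]
    simp
  rw [Finset.sum_congr rfl h1, Finset.sum_boole, Nat.cast_inj]
  symm
  refine Finset.card_bij (fun p _ => p.toFinsuppAntidiag) ?_ ?_ ?_
  · intro p hp
    obtain ⟨hpS, hpc⟩ := (Finset.mem_filter.mp hp).2
    refine Finset.mem_filter.mpr ⟨Finset.mem_finsuppAntidiag.mpr ⟨?_, ?_⟩, fun i hi => ?_⟩
    · conv_rhs => rw [← p.parts_sum, Finset.sum_multiset_count, hpS]
      rfl
    · exact hpS.le
    · obtain ⟨j, hj⟩ := hpc i hi
      exact ⟨j, by rw [← hj, mul_comm]; rfl⟩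
  · exact fun p _ q _ h => Nat.Partition.toFinsuppAntidiag_injective d h
  · intro g hg
    obtain ⟨hg, hgc⟩ := Finset.mem_filter.mp hg
    obtain ⟨hsum, hsupp⟩ := Finset.mem_finsuppAntidiag.mp hg
    have hpos : ∀ i ∈ S, g i / i ≠ 0 ∧ g i / i * i = g i := by
      intro i hi
      obtain ⟨j, hj⟩ := hgc i hi
      rw [hj, Nat.mul_div_cancel_left _ (Nat.pos_of_ne_zero (hS' i hi)), mul_comm i]
      exact ⟨by omega, rfl⟩
    let f : ℕ →₀ ℕ := Finsupp.onFinset S (fun i => if i ∈ S then g i / i else 0)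
      (fun i h => by by_contra hi; simp [hi] at h)
    have hf : ∀ i ∈ S, f i = g i / i := fun i hi => by simp [f, hi]
    have hf' : ∀ i ∉ S, f i = 0 := fun i hi => by simp [f, hi]
    have hfS : f.support = S := by
      ext i
      by_cases hi : i ∈ S
      · simp [hi, hf i hi, (hpos i hi).1, -Nat.div_eq_zero_iff]
      · simp [hi, hf' i hi]
    let p : d.Partition :=
      { parts := Finsupp.toMultiset f
        parts_pos := by
          intro i hi
          rw [Finsupp.mem_toMultiset, hfS] at hi
          exact Nat.pos_of_ne_zero (hS' i hi)
        parts_sum := by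
          rw [Finset.sum_multiset_count, Finsupp.toFinset_toMultiset, hfS, ← hsum]
          refine Finset.sum_congr rfl fun i hi => ?_
          simp [hf i hi, (hpos i hi).2] }
    have hcount : ∀ i, p.parts.count i = f i := fun i => Finsupp.count_toMultiset f i
    refine ⟨p, Finset.mem_filter.mpr ⟨Finset.mem_univ _, ?_, fun i hi => ?_⟩, ?_⟩
    · exact (Finsupp.toFinset_toMultiset f).trans hfS
    · obtain ⟨j, hj⟩ := hgc i hi
      refine ⟨j, ?_⟩
      rw [hcount, hf i hi, hj, Nat.mul_div_cancel_left _ (Nat.pos_of_ne_zero (hS' i hi))]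
    · ext i
      change p.parts.count i * i = g i
      rw [hcount]
      by_cases hi : i ∈ S
      · rw [hf i hi, (hpos i hi).2]
      · rw [hf' i hi, zero_mul]
        exact (Finsupp.notMem_support_iff.mp fun h => hi (hsupp h)).symm

/-- The odd numbers `1, 3, …, 2 n + 1`. -/
def oddsUpTo (n : ℕ) : Finset ℕ :=
  (Finset.range (n + 1)).image fun i => 2 * i + 1

lemma mem_oddsUpTo {n i : ℕ} : i ∈ oddsUpTo n ↔ Odd i ∧ i ≤ 2 * n + 1 := by
  simp only [oddsUpTo, Finset.mem_image, Finset.mem_range]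
  constructor
  · rintro ⟨j, hj, rfl⟩
    exact ⟨⟨j, rfl⟩, by omega⟩
  · rintro ⟨⟨j, rfl⟩, h⟩
    exact ⟨j, by omega, rfl⟩

lemma isOStarPartition_and_sup_iff {d n : ℕ} (p : d.Partition) :
    IsOStarPartition p ∧ p.parts.sup = 2 * n + 1 ↔
      p.parts.toFinset = oddsUpTo n ∧ ∀ i ∈ oddsUpTo n, ∃ j,
        p.parts.count i = 1 + (if i = 2 * n + 1 then 2 else 1) * j := by
  constructor
  · rintro ⟨⟨hodd, hlow, hcount⟩, hsup⟩
    have hmem : p.parts.sup ∈ p.parts := by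
      rw [← Multiset.one_le_count_iff_mem]
      exact hcount.pos
    rw [hsup] at hmem hcount
    have hS : ∀ i, i ∈ p.parts ↔ i ∈ oddsUpTo n := by
      intro i
      rw [mem_oddsUpTo]
      refine ⟨fun hi => ⟨hodd i hi, hsup ▸ Multiset.le_sup hi⟩, fun ⟨hi, hle⟩ => ?_⟩
      rcases hle.eq_or_lt with rfl | hlt
      · exact hmem
      · exact hlow _ hmem i hlt hi
    refine ⟨by ext i; rw [Multiset.mem_toFinset, hS], fun i hi => ?_⟩
    split_ifs with h
    · obtain ⟨j, hj⟩ := hcount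
      exact ⟨j, by rw [h, hj, add_comm]⟩
    · have := Multiset.one_le_count_iff_mem.mpr ((hS i).mpr hi)
      exact ⟨p.parts.count i - 1, by omega⟩
  · rintro ⟨hS, hcount⟩
    have hS' : ∀ i, i ∈ p.parts ↔ Odd i ∧ i ≤ 2 * n + 1 := by
      intro i
      rw [← Multiset.mem_toFinset, hS, mem_oddsUpTo]
    have htop : Odd (2 * n + 1) := ⟨n, rfl⟩
    have hsup : p.parts.sup = 2 * n + 1 :=
      le_antisymm (Multiset.sup_le.mpr fun i hi => ((hS' i).mp hi).2)
        (Multiset.le_sup ((hS' _).mpr ⟨htop, le_rfl⟩))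
    refine ⟨⟨fun i hi => ((hS' i).mp hi).1, fun i hi j hj hjo => (hS' j).mpr
      ⟨hjo, hj.le.trans ((hS' i).mp hi).2⟩, ?_⟩, hsup⟩
    obtain ⟨j, hj⟩ := hcount (2 * n + 1) (mem_oddsUpTo.mpr ⟨htop, le_rfl⟩)
    rw [if_pos rfl] at hj
    rw [hsup, hj]
    exact ⟨j, add_comm _ _⟩

lemma prod_geom_mul (n : ℕ) :
    (∏ i ∈ oddsUpTo n, (PowerSeries.X ^ i * geom ((if i = 2 * n + 1 then 2 else 1) * i))) *
      ((1 - PowerSeries.X ^ (4 * n + 2)) * oddPoch n) = PowerSeries.X ^ ((n + 1) ^ 2) := by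
  have hinj : Function.Injective fun i : ℕ => 2 * i + 1 := fun i j h => by simpa using h
  have h1 : ∀ i ∈ Finset.range n, (PowerSeries.X ^ (2 * i + 1) *
      geom ((if 2 * i + 1 = 2 * n + 1 then 2 else 1) * (2 * i + 1))) *
      (1 - PowerSeries.X ^ (2 * i + 1)) = PowerSeries.X ^ (2 * i + 1) := by
    intro i hi
    rw [if_neg (by grind), one_mul, mul_assoc, mul_comm (geom _), one_sub_mul_geom (by omega),
      mul_one]
  have h2 := Finset.prod_congr rfl h1
  rw [Finset.prod_mul_distrib, Finset.prod_pow_eq_pow_sum] at h2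
  have h3 : ∀ n, ∑ i ∈ Finset.range n, (2 * i + 1) = n ^ 2 := by
    intro n
    induction n with
    | zero => rfl
    | succ n ih => rw [Finset.sum_range_succ, ih]; ring
  rw [h3] at h2
  have h4 := one_sub_mul_geom (d := 2 * (2 * n + 1)) (by omega)
  rw [oddsUpTo, Finset.prod_image hinj.injOn, Finset.prod_range_succ, if_pos rfl, oddPoch,
    show 4 * n + 2 = 2 * (2 * n + 1) by ring]
  linear_combination (PowerSeries.X ^ (2 * n + 1) * (1 - PowerSeries.X ^ (2 * (2 * n + 1))) *
    geom (2 * (2 * n + 1))) * h2 + PowerSeries.X ^ (n ^ 2) * PowerSeries.X ^ (2 * n + 1) * h4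

lemma tripleSum_eq (n : ℕ) :
    tripleSum n = (-1) ^ (n + 1) *
      ∏ i ∈ oddsUpTo n, (PowerSeries.X ^ i * geom ((if i = 2 * n + 1 then 2 else 1) * i)) := by
  have h := prod_geom_mul n
  refine mul_right_cancel₀ (right_ne_zero_of_mul (h ▸ pow_ne_zero _ PowerSeries.X_ne_zero)) ?_
  rw [mul_assoc, h, tripleSum_mul]

lemma OStar_eq_sum (d : ℕ) :
    OStar d = ∑ n ∈ Finset.range (d + 1), PowerSeries.coeff d (tripleSum n) := by
  classical
  rw [OStar, ← Finset.sum_fiberwise_of_maps_to (g := fun p : d.Partition => (p.parts.sup - 1) / 2)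
    (t := Finset.range (d + 1))]
  · refine Finset.sum_congr rfl fun n _ => ?_
    rw [tripleSum_eq, ← map_one (PowerSeries.C (R := ℤ)), ← map_neg, ← map_pow,
      PowerSeries.coeff_C_mul, coeff_prod_geom _ (by simp [mem_oddsUpTo]) _
      (by intro i; split_ifs <;> simp), ← nsmul_eq_mul', ← Finset.sum_const]
    refine Finset.sum_congr ?_ fun p hp => ?_
    · ext p
      simp only [Finset.mem_filter, Finset.mem_univ, true_and]
      rw [← isOStarPartition_and_sup_iff]
      refine and_congr_right fun hp => ?_
      have : Odd p.parts.sup := hp.1 _ (Multiset.one_le_count_iff_mem.mp hp.2.2.pos)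
      grind
    · have h := (isOStarPartition_and_sup_iff p).mpr (Finset.mem_filter.mp hp).2
      rw [oWeight, h.2]
      split_ifs with h4
      · exact (Odd.neg_one_pow (by grind)).symm
      · exact (Even.neg_one_pow (by grind)).symm
  · intro p _
    have : p.parts.sup ≤ d := Multiset.sup_le.mpr fun i hi => p.le_of_mem_parts hi
    grind

lemma coeff_tripleTerm_eq_zero {d k a m : ℕ} (h : d ≤ k + a + m) :
    PowerSeries.coeff d (tripleTerm k a m) = 0 := by
  have h1 : PowerSeries.X ^ ((k + 1 + a + m) ^ 2 + (a ^ 2 + 2 * k * a + a + m)) ∣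
      tripleTerm k a m :=
    Dvd.dvd.mul_right (X_pow_dvd_of_le le_rfl _ _ _ _) _
  exact PowerSeries.X_pow_dvd_iff.mp h1 d (by nlinarith [Nat.zero_le (a ^ 2 + 2 * k * a + a + m)])

lemma sum_triangle_eq {A : Type*} [AddCommMonoid A] (d : ℕ) (f : ℕ → ℕ → ℕ → A)
    (hf : ∀ k a m, d < k + a + m → f k a m = 0) :
    ∑ n ∈ Finset.range (d + 1), ∑ k ∈ Finset.range (n + 1), ∑ a ∈ Finset.range (n - k + 1),
      f k a (n - k - a) =
    ∑ k ∈ Finset.range (d + 1), ∑ a ∈ Finset.range (d + 1), ∑ m ∈ Finset.range (d + 1),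
      f k a m := by
  have h1 : ∀ n ∈ Finset.range (d + 1), ∑ k ∈ Finset.range (n + 1),
      ∑ a ∈ Finset.range (n - k + 1), f k a (n - k - a) =
      ∑ k ∈ Finset.range (d + 1), ∑ a ∈ Finset.range (d + 1),
        if k + a ≤ n then f k a (n - k - a) else 0 := by
    intro n hn
    rw [← Finset.sum_subset (Finset.range_subset_range.mpr (by grind : n + 1 ≤ d + 1))]
    · refine Finset.sum_congr rfl fun k hk => ?_
      rw [← Finset.sum_filter]
      refine Finset.sum_congr (by ext; grind) fun _ _ => rfl
    · intro k _ hk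
      exact Finset.sum_eq_zero fun a _ => if_neg (by grind)
  rw [Finset.sum_congr rfl h1, Finset.sum_comm]
  refine Finset.sum_congr rfl fun k hk => ?_
  rw [Finset.sum_comm]
  refine Finset.sum_congr rfl fun a ha => ?_
  rw [← Finset.sum_filter, ← Finset.sum_filter_add_sum_filter_not (Finset.range (d + 1))
    (fun m => k + a + m ≤ d)]
  rw [Finset.sum_eq_zero (s := Finset.filter (fun m => ¬ k + a + m ≤ d) _)
    (fun m hm => hf k a m (by grind)), add_zero]
  refine Finset.sum_nbij' (fun n => n - k - a) (fun m => k + a + m) ?_ ?_ ?_ ?_ ?_ <;> grind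

/-- The pairs `(k, a)` for which the exponent `thetaExp k a` is `d`. -/
def thetaPairs (d : ℕ) : Finset (ℕ × ℕ) :=
  (Finset.range (d + 1) ×ˢ Finset.range (d + 1)).filter fun x => thetaExp x.1 x.2 = d

/-- The pairs `(k, a)` for which the exponent `thetaExp k a + 2 (k + 1 + a)` is `d`. -/
def thetaPairs' (d : ℕ) : Finset (ℕ × ℕ) :=
  (Finset.range (d + 1) ×ˢ Finset.range (d + 1)).filter fun x =>
    thetaExp x.1 x.2 + 2 * (x.1 + 1 + x.2) = d

lemma add_lt_thetaExp (k a : ℕ) : k + a < thetaExp k a := by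
  unfold thetaExp
  nlinarith [Nat.zero_le (a ^ 2 + 2 * k * a + a)]

lemma mem_thetaPairs {d : ℕ} {x : ℕ × ℕ} : x ∈ thetaPairs d ↔ thetaExp x.1 x.2 = d := by
  have := add_lt_thetaExp x.1 x.2
  simp only [thetaPairs, Finset.mem_filter, Finset.mem_product, Finset.mem_range]
  omega

lemma mem_thetaPairs' {d : ℕ} {x : ℕ × ℕ} :
    x ∈ thetaPairs' d ↔ thetaExp x.1 x.2 + 2 * (x.1 + 1 + x.2) = d := by
  have := add_lt_thetaExp x.1 x.2
  simp only [thetaPairs', Finset.mem_filter, Finset.mem_product, Finset.mem_range]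
  omega

lemma neg_one_pow_thetaExp (k a : ℕ) : (-1 : ℤ) ^ thetaExp k a = (-1) ^ (k + 1 + a) := by
  rw [neg_one_pow_congr]
  simp only [thetaExp, Nat.even_add, Nat.even_pow, Nat.even_mul]
  grind

theorem OStar_eq_card (d : ℕ) :
    OStar d = (-1) ^ d * ((thetaPairs d).card + (thetaPairs' d).card) := by
  rw [OStar_eq_sum]
  simp only [tripleSum, map_sum]
  rw [sum_triangle_eq d (fun k a m => PowerSeries.coeff d (tripleTerm k a m))
    fun k a m h => coeff_tripleTerm_eq_zero h.le]
  have h1 : ∀ k a, ∑ m ∈ Finset.range (d + 1), PowerSeries.coeff d (tripleTerm k a m) =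
      (-1) ^ d * ((if thetaExp k a = d then 1 else 0) +
        (if thetaExp k a + 2 * (k + 1 + a) = d then 1 else 0)) := by
    intro k a
    have h := ((PowerSeries.WithPiTopology.hasSum_iff_hasSum_coeff _).mp (hasSum_tripleTerm k a)) d
    have h' : HasSum (fun m => PowerSeries.coeff d (tripleTerm k a m)) _ :=
      hasSum_sum_of_ne_finset_zero (s := Finset.range (d + 1))
      fun m hm => coeff_tripleTerm_eq_zero (by grind)
    rw [h'.unique h, ← map_one (PowerSeries.C (R := ℤ)), ← map_neg, ← map_pow,
      PowerSeries.coeff_C_mul, map_add, PowerSeries.coeff_X_pow, PowerSeries.coeff_X_pow,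
      ← neg_one_pow_thetaExp]
    simp only [eq_comm (a := d)]
    split_ifs with h2 h3 h3
    · omega
    · rw [h2]
    · rw [← h3, pow_add, pow_mul]; simp
    · simp
  simp only [h1]
  simp only [← Finset.mul_sum, Finset.sum_add_distrib]
  rw [← Finset.sum_product', ← Finset.sum_product', Finset.sum_boole, Finset.sum_boole]
  rfl

namespace QSqrtTwo

/-- The element `√2` of `ℚ(√2)`. -/
noncomputable def root : QSqrtTwo := IntermediateField.AdjoinSimple.gen ℚ √(2 : ℝ)

lemma coe_root : (root : ℝ) = √2 := IntermediateField.AdjoinSimple.coe_gen ℚ _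

lemma root_mul_root : root * root = 2 := by
  apply Subtype.ext
  push_cast
  rw [coe_root]
  exact Real.mul_self_sqrt zero_le_two

lemma linearIndependent_one_root : LinearIndependent ℚ ![(1 : QSqrtTwo), root] := by
  rw [LinearIndependent.pair_iff]
  intro p q h
  have h' : (p : ℝ) + q * √2 = 0 := by
    have := congrArg (fun z : QSqrtTwo => (z : ℝ)) h
    simpa [Algebra.smul_def, coe_root] using this
  have hq : q = 0 := by
    by_contra hq
    have := (irrational_sqrt_two.ratCast_mul hq).ratCast_add p
    rw [h'] at this
    exact this ⟨0, by simp⟩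
  subst hq
  simpa using h'

lemma finrank_eq_two : Module.finrank ℚ QSqrtTwo = 2 := by
  have hint : IsIntegral ℚ √(2 : ℝ) :=
    ⟨Polynomial.X ^ 2 - Polynomial.C 2, Polynomial.monic_X_pow_sub_C 2 two_ne_zero, by simp⟩
  apply le_antisymm
  · rw [IntermediateField.adjoin.finrank hint]
    have hdvd : minpoly ℚ √(2 : ℝ) ∣ Polynomial.X ^ 2 - Polynomial.C 2 :=
      minpoly.dvd _ _ (by simp)
    simpa using Polynomial.natDegree_le_of_dvd hdvd (Polynomial.X_pow_sub_C_ne_zero two_pos _)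
  · simpa using linearIndependent_one_root.fintype_card_le_finrank

/-- The basis `1, √2` of `ℚ(√2)`. -/
noncomputable def basis : Module.Basis (Fin 2) ℚ QSqrtTwo :=
  basisOfLinearIndependentOfCardEqFinrank linearIndependent_one_root (by simp [finrank_eq_two])

lemma basis_zero : basis 0 = 1 := by simp [basis]

lemma basis_one : basis 1 = root := by simp [basis]

lemma exists_eq_add (z : QSqrtTwo) : ∃ p q : ℚ, z = p • basis 0 + q • basis 1 :=
  ⟨basis.repr z 0, basis.repr z 1, by
    conv_lhs => rw [← basis.sum_repr z, Fin.sum_univ_two]⟩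

lemma leftMulMatrix_eq (p q : ℚ) :
    Algebra.leftMulMatrix basis (p • basis 0 + q • basis 1) = !![p, 2 * q; q, p] := by
  have h0 : (p • basis 0 + q • basis 1) * basis 0 = p • basis 0 + q • basis 1 := by
    rw [basis_zero, mul_one]
  have h1 : (p • basis 0 + q • basis 1) * basis 1 = (2 * q) • basis 0 + p • basis 1 := by
    simp only [basis_zero, basis_one, add_mul, smul_mul_assoc, one_mul, root_mul_root]
    rw [mul_comm, mul_smul, add_comm, ofNat_smul_eq_nsmul, two_nsmul, ← one_add_one_eq_two,
      smul_add]
  ext i j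
  rw [Algebra.leftMulMatrix_eq_repr_mul]
  fin_cases i <;> fin_cases j <;> simp [h0, h1]

lemma norm_eq (p q : ℚ) : Algebra.norm ℚ (p • basis 0 + q • basis 1) = p ^ 2 - 2 * q ^ 2 := by
  rw [Algebra.norm_eq_matrix_det basis, leftMulMatrix_eq, Matrix.det_fin_two_of]
  ring

lemma trace_eq (p q : ℚ) : Algebra.trace ℚ QSqrtTwo (p • basis 0 + q • basis 1) = 2 * p := by
  rw [Algebra.trace_eq_matrix_trace basis, leftMulMatrix_eq, Matrix.trace_fin_two_of]
  ring

lemma exists_int_of_trace_norm {p q : ℚ} {A B : ℤ} (hA : (A : ℚ) = 2 * p)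
    (hB : (B : ℚ) = p ^ 2 - 2 * q ^ 2) : (∃ x : ℤ, (x : ℚ) = p) ∧ ∃ y : ℤ, (y : ℚ) = q := by
  have h1 : (4 * q) ^ 2 = ((2 * (A ^ 2 - 4 * B) : ℤ) : ℚ) := by
    push_cast
    rw [hA, hB]
    ring
  obtain ⟨C, hC⟩ : ∃ C : ℤ, (C : ℚ) = 4 * q := by
    have : IsIntegral ℤ (4 * q) := by
      refine IsIntegral.of_pow two_pos ?_
      rw [h1]
      exact isIntegral_algebraMap (R := ℤ) (A := ℚ)
    exact IsIntegrallyClosed.isIntegral_iff.mp this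
  rw [← hC] at h1
  have h2 : C ^ 2 = 2 * (A ^ 2 - 4 * B) := by exact_mod_cast h1
  have hCe : Even C := by
    have : Even (C ^ 2) := ⟨A ^ 2 - 4 * B, by rw [h2]; ring⟩
    exact (Int.even_pow.mp this).1
  obtain ⟨c, rfl⟩ := hCe
  have hAe : Even A := by
    have : Even (A ^ 2) := ⟨c ^ 2 + 2 * B, by linarith⟩
    exact (Int.even_pow.mp this).1
  obtain ⟨x, rfl⟩ := hAe
  have hce : Even c := by
    have : Even (c ^ 2) := ⟨x ^ 2 - B, by linarith⟩
    exact (Int.even_pow.mp this).1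
  obtain ⟨y, rfl⟩ := hce
  push_cast at hA hC
  exact ⟨⟨x, by linarith⟩, ⟨y, by linarith⟩⟩

/-- The algebraic integer `√2`. -/
noncomputable def rootInt : 𝓞 QSqrtTwo :=
  ⟨root, ⟨Polynomial.X ^ 2 - Polynomial.C 2, Polynomial.monic_X_pow_sub_C 2 two_ne_zero,
    by simp [pow_two, root_mul_root]⟩⟩

lemma coe_rootInt : (rootInt : QSqrtTwo) = root := rfl

/-- The integer `x + y √2` of `ℚ(√2)`. -/
noncomputable def toInt (x y : ℤ) : 𝓞 QSqrtTwo := x + y * rootInt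

lemma coe_toInt (x y : ℤ) :
    (toInt x y : QSqrtTwo) = (x : ℚ) • basis 0 + (y : ℚ) • basis 1 := by
  simp [toInt, basis_zero, basis_one, Algebra.smul_def, coe_rootInt]

lemma toInt_mul (x y z w : ℤ) :
    toInt x y * toInt z w = toInt (x * z + 2 * y * w) (x * w + y * z) := by
  apply NumberField.RingOfIntegers.ext
  simp only [map_mul, coe_toInt, basis_zero, basis_one, Algebra.smul_def]
  push_cast
  simp
  linear_combination (y * w : QSqrtTwo) * root_mul_root

lemma toInt_add (x y z w : ℤ) : toInt x y + toInt z w = toInt (x + z) (y + w) := by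
  simp only [toInt]
  push_cast
  ring

lemma exists_toInt (z : 𝓞 QSqrtTwo) : ∃ x y : ℤ, z = toInt x y := by
  obtain ⟨p, q, hz⟩ := exists_eq_add z
  have hint : IsIntegral ℤ (z : QSqrtTwo) := z.isIntegral_coe
  have h1 : IsIntegral ℤ (Algebra.trace ℚ QSqrtTwo (z : QSqrtTwo)) := Algebra.isIntegral_trace hint
  have h2 : IsIntegral ℤ (Algebra.norm ℚ (z : QSqrtTwo)) := Algebra.isIntegral_norm ℚ hint
  rw [hz, trace_eq] at h1
  rw [hz, norm_eq] at h2
  obtain ⟨A, hA⟩ := IsIntegrallyClosed.isIntegral_iff.mp h1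
  obtain ⟨B, hB⟩ := IsIntegrallyClosed.isIntegral_iff.mp h2
  obtain ⟨⟨x, rfl⟩, ⟨y, rfl⟩⟩ := exists_int_of_trace_norm (by simpa using hA) (by simpa using hB)
  exact ⟨x, y, NumberField.RingOfIntegers.ext (hz.trans (coe_toInt x y).symm)⟩

lemma norm_toInt (x y : ℤ) : Algebra.norm ℤ (toInt x y) = x ^ 2 - 2 * y ^ 2 := by
  have h := Algebra.coe_norm_int (toInt x y)
  rw [coe_toInt, norm_eq] at h
  exact_mod_cast h

lemma toInt_injective {x y z w : ℤ} (h : toInt x y = toInt z w) : x = z ∧ y = w := by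
  have h' := congrArg (fun u : 𝓞 QSqrtTwo => (u : QSqrtTwo)) h
  simp only [coe_toInt] at h'
  have h0 := congrArg (fun u => basis.repr u 0) h'
  have h1 := congrArg (fun u => basis.repr u 1) h'
  simp at h0 h1
  exact ⟨h0, h1⟩

lemma absNorm_span_toInt (x y : ℤ) :
    (Ideal.absNorm (Ideal.span {toInt x y}) : ℤ) = |x ^ 2 - 2 * y ^ 2| := by
  rw [Ideal.absNorm_span_singleton, norm_toInt, Int.natCast_natAbs]

end QSqrtTwo

lemma Int.exists_two_mul_abs_sub_mul_le (A : ℤ) {N : ℤ} (hN : N ≠ 0) :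
    ∃ u : ℤ, 2 * |A - u * N| ≤ |N| := by
  have h1 := Int.emod_nonneg A hN
  have h2 := Int.emod_lt_abs A hN
  have h3 := Int.emod_add_mul_ediv A N
  by_cases h : 2 * (A % N) ≤ |N|
  · refine ⟨A / N, ?_⟩
    rwa [show A - A / N * N = A % N by linarith, abs_of_nonneg h1]
  · refine ⟨A / N + N.sign, ?_⟩
    have h4 : N.sign * N = |N| := Int.sign_mul_self_eq_abs N
    rw [show A - (A / N + N.sign) * N = A % N - |N| by linarith, abs_of_neg (by linarith)]
    linarith

namespace QSqrtTwo

lemma norm_toInt_ne_zero {x y : ℤ} (h : toInt x y ≠ 0) : x ^ 2 - 2 * y ^ 2 ≠ 0 := by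
  rw [← norm_toInt]
  exact Algebra.norm_ne_zero_iff.mpr h

lemma exists_eq_span_toInt (I : Ideal (𝓞 QSqrtTwo)) : ∃ x y : ℤ, I = Ideal.span {toInt x y} := by
  by_cases hI : I = ⊥
  · exact ⟨0, 0, by simp [hI, toInt]⟩
  have hex : ∃ n : ℕ, ∃ c d : ℤ, toInt c d ∈ I ∧ toInt c d ≠ 0 ∧
      n = (c ^ 2 - 2 * d ^ 2).natAbs := by
    obtain ⟨z, hz, hz0⟩ := Submodule.exists_mem_ne_zero_of_ne_bot hI
    obtain ⟨c, d, rfl⟩ := exists_toInt z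
    exact ⟨_, c, d, hz, hz0, rfl⟩
  classical
  obtain ⟨c, d, hw, hw0, hn⟩ := Nat.find_spec hex
  have hmin : ∀ e f : ℤ, toInt e f ∈ I → (e ^ 2 - 2 * f ^ 2).natAbs <
      (c ^ 2 - 2 * d ^ 2).natAbs → toInt e f = 0 := by
    intro e f hef hlt
    by_contra h0
    exact Nat.find_min hex (hn ▸ hlt) ⟨e, f, hef, h0, rfl⟩
  have hN := norm_toInt_ne_zero hw0
  refine ⟨c, d, le_antisymm (fun z hz => ?_) ((Ideal.span_singleton_le_iff_mem I).mpr hw)⟩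
  obtain ⟨a, b, rfl⟩ := exists_toInt z
  obtain ⟨u, hu⟩ := Int.exists_two_mul_abs_sub_mul_le (a * c - 2 * b * d) hN
  obtain ⟨v, hv⟩ := Int.exists_two_mul_abs_sub_mul_le (b * c - a * d) hN
  have hdecomp : toInt a b = toInt u v * toInt c d +
      toInt (a - (u * c + 2 * v * d)) (b - (u * d + v * c)) := by
    rw [toInt_mul, toInt_add]
    congr 1 <;> ring
  have hrem : toInt (a - (u * c + 2 * v * d)) (b - (u * d + v * c)) ∈ I := by
    rw [← sub_eq_of_eq_add' hdecomp]
    exact I.sub_mem hz (I.mul_mem_left _ hw)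
  have h0 := hmin _ _ hrem (by
    rw [← Int.ofNat_lt, Int.natCast_natAbs, Int.natCast_natAbs]
    generalize hA : a * c - 2 * b * d - u * (c ^ 2 - 2 * d ^ 2) = e at hu
    generalize hB : b * c - a * d - v * (c ^ 2 - 2 * d ^ 2) = f at hv
    generalize hR : (a - (u * c + 2 * v * d)) ^ 2 - 2 * (b - (u * d + v * c)) ^ 2 = R
    have hmul : R * (c ^ 2 - 2 * d ^ 2) = e ^ 2 - 2 * f ^ 2 := by
      rw [← hR, ← hA, ← hB]; ring
    generalize c ^ 2 - 2 * d ^ 2 = N at *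
    have hNpos : 0 < |N| := abs_pos.mpr hN
    have habs : |R| * |N| = |e ^ 2 - 2 * f ^ 2| := by rw [← abs_mul, hmul]
    have he : 4 * e ^ 2 ≤ |N| ^ 2 := by
      rw [← sq_abs e]; nlinarith [abs_nonneg e]
    have hf : 4 * f ^ 2 ≤ |N| ^ 2 := by
      rw [← sq_abs f]; nlinarith [abs_nonneg f]
    have hle : 2 * |e ^ 2 - 2 * f ^ 2| ≤ |N| ^ 2 := by
      rcases abs_cases (e ^ 2 - 2 * f ^ 2) with h | h <;> nlinarith [sq_nonneg e, sq_nonneg f]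
    by_contra hlt
    nlinarith)
  rw [hdecomp, h0, add_zero]
  exact Ideal.mul_mem_left _ _ (Ideal.mem_span_singleton_self _)

lemma span_toInt_mul {x y u v u' v' : ℤ} (h : toInt u v * toInt u' v' = 1) :
    Ideal.span {toInt u v * toInt x y} = Ideal.span {toInt x y} :=
  Ideal.span_singleton_mul_left_unit (IsUnit.of_mul_eq_one _ h) _

lemma span_toInt_neg (x y : ℤ) : Ideal.span {toInt (-x) (-y)} = Ideal.span {toInt x y} := by
  have h := span_toInt_mul (x := x) (y := y) (u := -1) (v := 0) (u' := -1) (v' := 0)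
    (by rw [toInt_mul]; simp [toInt])
  rw [← h, toInt_mul]
  congr 3 <;> ring

lemma span_toInt_one_add (x y : ℤ) :
    Ideal.span {toInt (x + 2 * y) (x + y)} = Ideal.span {toInt x y} := by
  have h := span_toInt_mul (x := x) (y := y) (u := 1) (v := 1) (u' := -1) (v' := 1)
    (by rw [toInt_mul]; simp [toInt])
  rw [← h, toInt_mul]
  congr 3 <;> ring

lemma span_toInt_sub (x y : ℤ) :
    Ideal.span {toInt (3 * x - 4 * y) (3 * y - 2 * x)} = Ideal.span {toInt x y} := by
  have h := span_toInt_mul (x := x) (y := y) (u := 3) (v := -2) (u' := 3) (v' := 2)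
    (by rw [toInt_mul]; simp [toInt])
  rw [← h, toInt_mul]
  congr 3 <;> ring

lemma span_toInt_add (x y : ℤ) :
    Ideal.span {toInt (3 * x + 4 * y) (3 * y + 2 * x)} = Ideal.span {toInt x y} := by
  have h := span_toInt_mul (x := x) (y := y) (u := 3) (v := 2) (u' := 3) (v' := -2)
    (by rw [toInt_mul]; simp [toInt])
  rw [← h, toInt_mul]
  congr 3

/-- The pairs `(x, y)` in the chosen fundamental domain with `x ^ 2 - 2 y ^ 2 = M`. -/
def IsReduced (M x y : ℤ) : Prop := 0 < x ∧ 2 * |y| < x ∧ x ^ 2 - 2 * y ^ 2 = M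

lemma exists_isReduced {I : Ideal (𝓞 QSqrtTwo)} {M : ℤ} (hM : Odd M)
    (hI : (Ideal.absNorm I : ℤ) = M) : ∃ x y : ℤ, IsReduced M x y ∧ I = Ideal.span {toInt x y} := by
  have hex : ∃ n : ℕ, ∃ y : ℤ, (n : ℤ) ^ 2 - 2 * y ^ 2 = M ∧ I = Ideal.span {toInt n y} := by
    obtain ⟨x, y, hspan⟩ := exists_eq_span_toInt I
    have hsign : ∃ x y : ℤ, x ^ 2 - 2 * y ^ 2 = M ∧ I = Ideal.span {toInt x y} := by
      rw [hspan, absNorm_span_toInt] at hI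
      rcases abs_cases (x ^ 2 - 2 * y ^ 2) with h | h
      · exact ⟨x, y, by rw [← hI, h.1], hspan⟩
      · exact ⟨x + 2 * y, x + y, by rw [← hI, h.1]; ring, by rw [span_toInt_one_add, hspan]⟩
    obtain ⟨x, y, hxy, hspan⟩ := hsign
    rcases abs_cases x with h | h
    · exact ⟨x.natAbs, y, by rwa [Int.natCast_natAbs, h.1], by rwa [Int.natCast_natAbs, h.1]⟩
    · exact ⟨x.natAbs, -y, by rwa [Int.natCast_natAbs, h.1, neg_sq, neg_sq],
        by rwa [Int.natCast_natAbs, h.1, span_toInt_neg]⟩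
  classical
  obtain ⟨y, hy, hspan⟩ := Nat.find_spec hex
  have hmin : ∀ x' y' : ℤ, 0 ≤ x' → x' < Nat.find hex → x' ^ 2 - 2 * y' ^ 2 = M →
      I ≠ Ideal.span {toInt x' y'} := by
    intro x' y' h0 hlt hM' hI'
    lift x' to ℕ using h0
    exact Nat.find_min hex (by exact_mod_cast hlt) ⟨y', hM', hI'⟩
  have hx0 : (0 : ℤ) ≤ Nat.find hex := Int.natCast_nonneg _
  generalize (Nat.find hex : ℤ) = x at *
  have hMnn : 0 ≤ M := by rw [← hI]; exact Int.natCast_nonneg _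
  have hMpos : 0 < M := lt_of_le_of_ne hMnn (by rintro rfl; simp at hM)
  have hxpos : 0 < x := by
    rcases hx0.eq_or_lt with h | h
    · rw [← h] at hy; nlinarith [sq_nonneg y]
    · exact h
  refine ⟨x, y, ⟨hxpos, lt_of_le_of_ne ?_ ?_, hy⟩, hspan⟩
  · by_contra! hlt
    rcases abs_cases y with ⟨h, h'⟩ | ⟨h, h'⟩ <;> rw [h] at hlt
    · refine hmin (3 * x - 4 * y) (3 * y - 2 * x) ?_ (by linarith) (by rw [← hy]; ring)
        (by rw [span_toInt_sub, hspan])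
      by_contra! h3
      nlinarith
    · refine hmin (3 * x + 4 * y) (3 * y + 2 * x) ?_ (by linarith) (by rw [← hy]; ring)
        (by rw [span_toInt_add, hspan])
      by_contra! h3
      nlinarith
  · intro h
    have : x ^ 2 = 4 * y ^ 2 := by rw [← h, mul_pow, sq_abs]; ring
    rw [← hy, this] at hM
    exact absurd hM (by rw [Int.not_odd_iff_even]; exact ⟨y ^ 2, by ring⟩)

lemma IsReduced.eq_of_span_eq {M x y x' y' : ℤ} (h : IsReduced M x y) (h' : IsReduced M x' y')
    (hspan : Ideal.span {toInt x y} = Ideal.span {toInt x' y'}) : x = x' ∧ y = y' := by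
  obtain ⟨hx, hy, hM⟩ := h
  obtain ⟨hx', hy', hM'⟩ := h'
  have hmem : toInt x' y' ∈ Ideal.span {toInt x y} :=
    hspan ▸ Ideal.mem_span_singleton_self _
  obtain ⟨u, hu⟩ := Ideal.mem_span_singleton'.mp hmem
  obtain ⟨a, b, rfl⟩ := exists_toInt u
  rw [toInt_mul] at hu
  obtain ⟨hxx, hyy⟩ := toInt_injective hu
  have hy2 : 4 * y ^ 2 < x ^ 2 := by rw [← sq_abs y]; nlinarith [abs_nonneg y]
  have hy2' : 4 * y' ^ 2 < x' ^ 2 := by rw [← sq_abs y']; nlinarith [abs_nonneg y']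
  have hMpos : 0 < M := by nlinarith
  have hprod : 4 * |y * y'| < x * x' := by
    rw [abs_mul]; nlinarith [abs_nonneg y, abs_nonneg y']
  have haM : a * M = x * x' - 2 * (y * y') := by rw [← hM, ← hxx, ← hyy]; ring
  have hle := le_abs_self (y * y')
  have hge := neg_abs_le (y * y')
  have hapos : 0 < a := by
    by_contra! ha
    nlinarith
  have halt : a < 3 := by
    by_contra! ha
    nlinarith [sq_nonneg (x - x')]
  have hab : a ^ 2 - 2 * b ^ 2 = 1 := by
    have : (a ^ 2 - 2 * b ^ 2) * M = 1 * M := by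
      rw [one_mul]
      conv_rhs => rw [← hM', ← hxx, ← hyy]
      rw [← hM]; ring
    exact mul_right_cancel₀ hMpos.ne' this
  interval_cases a
  · have hb : b = 0 := by
      have : b ^ 2 = 0 := by linarith
      exact pow_eq_zero_iff two_ne_zero |>.mp this
    subst hb
    exact ⟨by linarith, by linarith⟩
  · omega

/-- The points of the fundamental domain are parametrized by the exponents of the theta series. -/
def reducedPoint : Bool × ((ℕ × ℕ) ⊕ (ℕ × ℕ)) → ℤ × ℤ
  | (s, .inl (k, a)) => (4 * (k + 1 + a) - 1, (if s then 1 else -1) * (2 * k + 1))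
  | (s, .inr (k, a)) => (4 * (k + 1 + a) + 1, (if s then 1 else -1) * (2 * k + 1))

/-- The index set of the points of norm `8 d - 1` in the fundamental domain. -/
def reducedIndices (d : ℕ) : Finset (Bool × ((ℕ × ℕ) ⊕ (ℕ × ℕ))) :=
  Finset.univ ×ˢ (thetaPairs d).disjSum (thetaPairs' d)

lemma card_reducedIndices (d : ℕ) :
    (reducedIndices d).card = 2 * ((thetaPairs d).card + (thetaPairs' d).card) := by
  simp [reducedIndices]

lemma reducedPoint_injective : Function.Injective reducedPoint := by
  rintro ⟨s, ⟨k, a⟩ | ⟨k, a⟩⟩ ⟨s', ⟨k', a'⟩ | ⟨k', a'⟩⟩ h <;>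
  simp only [reducedPoint, Prod.mk.injEq] at h <;>
  obtain ⟨h1, h2⟩ := h <;>
  cases s <;> cases s' <;> simp at h2 ⊢ <;> omega

lemma isReduced_reducedPoint {d : ℕ} {i : Bool × ((ℕ × ℕ) ⊕ (ℕ × ℕ))} (hi : i ∈ reducedIndices d) :
    IsReduced (8 * d - 1) (reducedPoint i).1 (reducedPoint i).2 := by
  obtain ⟨s, ⟨k, a⟩ | ⟨k, a⟩⟩ := i
  · have h : thetaExp k a = d := by simpa [reducedIndices, mem_thetaPairs] using hi
    have hs : |(if s then (1 : ℤ) else -1) * (2 * k + 1)| = 2 * k + 1 := by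
      rw [abs_mul, abs_of_nonneg (by positivity : (0 : ℤ) ≤ 2 * k + 1)]
      cases s <;> simp
    refine ⟨by simp only [reducedPoint]; omega, by simp only [reducedPoint]; rw [hs]; omega, ?_⟩
    rw [← sq_abs (reducedPoint _).2]
    simp only [reducedPoint, hs]
    rw [← h, thetaExp]
    push_cast
    ring
  · have h : thetaExp k a + 2 * (k + 1 + a) = d := by
      simpa [reducedIndices, mem_thetaPairs'] using hi
    have hs : |(if s then (1 : ℤ) else -1) * (2 * k + 1)| = 2 * k + 1 := by
      rw [abs_mul, abs_of_nonneg (by positivity : (0 : ℤ) ≤ 2 * k + 1)]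
      cases s <;> simp
    refine ⟨by simp only [reducedPoint]; omega, by simp only [reducedPoint]; rw [hs]; omega, ?_⟩
    rw [← sq_abs (reducedPoint _).2]
    simp only [reducedPoint, hs]
    rw [← h, thetaExp]
    push_cast
    ring

lemma IsReduced.exists_reducedPoint {d : ℕ} {x y : ℤ} (h : IsReduced (8 * d - 1) x y) :
    ∃ i ∈ reducedIndices d, reducedPoint i = (x, y) := by
  obtain ⟨hx, hy, hM⟩ := h
  have hxo : Odd x := by
    have : Odd (x ^ 2) := ⟨y ^ 2 + 4 * d - 1, by linarith⟩
    exact (Int.odd_pow.mp this).resolve_right two_ne_zero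
  have hyo : Odd y := by
    obtain ⟨j, rfl⟩ := hxo
    have hev : Even (j * (j + 1)) := Int.even_mul_succ_self j
    obtain ⟨t, ht⟩ := hev
    have : Odd (y ^ 2) := ⟨2 * t - 2 * d, by linarith⟩
    exact (Int.odd_pow.mp this).resolve_right two_ne_zero
  obtain ⟨s, k, hk⟩ : ∃ (s : Bool) (k : ℕ), y = (if s then 1 else -1) * (2 * k + 1) := by
    obtain ⟨j, rfl⟩ := hyo
    rcases le_or_gt 0 j with hj | hj
    · exact ⟨true, j.toNat, by simp [hj]⟩
    · exact ⟨false, (-j - 1).toNat, by simp; omega⟩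
  have hyabs : |y| = 2 * k + 1 := by
    rw [hk, abs_mul, abs_of_nonneg (by positivity : (0 : ℤ) ≤ 2 * k + 1)]
    cases s <;> simp
  rw [← sq_abs y, hyabs] at hM
  rw [hyabs] at hy
  obtain ⟨a, ha | ha⟩ : ∃ a : ℕ, x = 4 * (k + 1 + a) - 1 ∨ x = 4 * (k + 1 + a) + 1 := by
    obtain ⟨j, rfl⟩ := hxo
    exact ⟨((j + 1) / 2 - k - 1).toNat, by omega⟩
  · refine ⟨(s, .inl (k, a)), ?_, by simp only [reducedPoint, ha, hk]⟩
    suffices thetaExp k a = d by simpa [reducedIndices, mem_thetaPairs]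
    rw [ha] at hM
    zify [thetaExp]
    linarith
  · refine ⟨(s, .inr (k, a)), ?_, by simp only [reducedPoint, ha, hk]⟩
    suffices thetaExp k a + 2 * (k + 1 + a) = d by simpa [reducedIndices, mem_thetaPairs']
    rw [ha] at hM
    zify [thetaExp]
    linarith

theorem ncard_setOf_absNorm_eq (d : ℕ) :
    {I : Ideal (𝓞 QSqrtTwo) | (Ideal.absNorm I : ℤ) = 8 * d - 1}.ncard =
      2 * ((thetaPairs d).card + (thetaPairs' d).card) := by
  have himage : {I : Ideal (𝓞 QSqrtTwo) | (Ideal.absNorm I : ℤ) = 8 * d - 1} =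
      (fun i => Ideal.span {toInt (reducedPoint i).1 (reducedPoint i).2}) ''
        (reducedIndices d : Set (Bool × ((ℕ × ℕ) ⊕ (ℕ × ℕ)))) := by
    ext I
    constructor
    · intro hI
      obtain ⟨x, y, hxy, rfl⟩ := exists_isReduced ⟨4 * d - 1, by ring⟩ hI
      obtain ⟨i, hi, hi'⟩ := hxy.exists_reducedPoint
      exact ⟨i, hi, by simp only [hi']⟩
    · rintro ⟨i, hi, rfl⟩
      have h := isReduced_reducedPoint hi
      have hlt : 0 ≤ (8 * d - 1 : ℤ) := by
        rw [← h.2.2, ← sq_abs (reducedPoint i).2]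
        nlinarith [h.1, h.2.1, abs_nonneg (reducedPoint i).2]
      simp only [Set.mem_ofPred_eq, absNorm_span_toInt, h.2.2, abs_of_nonneg hlt]
  rw [himage, Set.InjOn.ncard_image, Set.ncard_coe_finset, card_reducedIndices]
  intro i hi j hj hij
  obtain ⟨h1, h2⟩ := (isReduced_reducedPoint hi).eq_of_span_eq (isReduced_reducedPoint hj) hij
  exact reducedPoint_injective (Prod.ext h1 h2)

end QSqrtTwo

lemma hasSum_OStar :
    HasSum (fun n : ℕ+ => PowerSeries.C (OStar n) * (PowerSeries.X : ℤ⟦X⟧) ^ (8 * (n : ℕ)))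
      (PowerSeries.mk fun m => if 8 ∣ m ∧ m ≠ 0 then OStar (m / 8) else 0) := by
  refine (PowerSeries.WithPiTopology.hasSum_iff_hasSum_coeff _).mpr fun m => ?_
  simp only [PowerSeries.coeff_C_mul, PowerSeries.coeff_X_pow, PowerSeries.coeff_mk]
  split_ifs with h
  · obtain ⟨⟨d, rfl⟩, hd⟩ := h
    have hs := hasSum_single (f := fun n : ℕ+ =>
      OStar n * if 8 * d = 8 * (n : ℕ) then 1 else 0) ⟨d, by omega⟩ (fun n hn => by
        rw [if_neg, mul_zero]
        intro h
        exact hn (PNat.eq (by simpa using h.symm)))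
    simpa using hs
  · convert hasSum_zero with n
    rw [if_neg, mul_zero]
    rintro rfl
    exact h ⟨Dvd.intro _ rfl, by simp⟩

lemma hasSum_ite_eq_ncard {α : Type*} {f : α → ℕ} {m : ℕ} (h : {a | f a = m}.Finite) (c : ℤ) :
    HasSum (fun a => if f a = m then c else 0) (c * ({a | f a = m}.ncard : ℤ)) := by
  have hs : HasSum (fun a => if f a = m then c else 0)
      (∑ a ∈ h.toFinset, if f a = m then c else 0) :=
    hasSum_sum_of_ne_finset_zero fun a ha => if_neg fun hm => ha (h.mem_toFinset.mpr hm)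
  refine hs.of_eq (fun _ => rfl) ?_
  have hc : ∀ a ∈ h.toFinset, (if f a = m then c else 0) = c :=
    fun a ha => if_pos (h.mem_toFinset.mp ha)
  rw [Finset.sum_congr rfl hc, Finset.sum_const, nsmul_eq_mul', Set.ncard_eq_toFinset_card _ h]

lemma hasSum_absNorm :
    HasSum (fun a : NormNegOneIdeal =>
      (-1) ^ ((Ideal.absNorm a.1 + 1) / 8) * (PowerSeries.X : ℤ⟦X⟧) ^ Ideal.absNorm a.1)
      (PowerSeries.mk fun m => if 8 ∣ m + 1 then (-1) ^ ((m + 1) / 8) *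
        ({I : Ideal (𝓞 QSqrtTwo) | Ideal.absNorm I = m}.ncard : ℤ) else 0) := by
  refine (PowerSeries.WithPiTopology.hasSum_iff_hasSum_coeff _).mpr fun m => ?_
  have hcoeff : ∀ a : NormNegOneIdeal, PowerSeries.coeff m
      ((-1) ^ ((Ideal.absNorm a.1 + 1) / 8) * (PowerSeries.X : ℤ⟦X⟧) ^ Ideal.absNorm a.1) =
      if Ideal.absNorm a.1 = m then (-1) ^ ((m + 1) / 8) else 0 := by
    intro a
    rw [← map_one (PowerSeries.C (R := ℤ)), ← map_neg, ← map_pow, PowerSeries.coeff_C_mul,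
      PowerSeries.coeff_X_pow, mul_ite, mul_one, mul_zero]
    simp only [eq_comm (a := m)]
    split_ifs with h
    · rw [h]
    · rfl
  simp only [hcoeff, PowerSeries.coeff_mk]
  split_ifs with h
  · have hfin : {a : NormNegOneIdeal | Ideal.absNorm a.1 = m}.Finite :=
      (Ideal.finite_setOfPred_absNorm_eq m).preimage Subtype.val_injective.injOn
    refine (hasSum_ite_eq_ncard hfin _).of_eq (fun _ => rfl) ?_
    congr 2
    rw [← Set.ncard_image_of_injective _ Subtype.val_injective]
    congr 1
    ext I
    constructor
    · intro hI
      refine ⟨⟨I, ?_⟩, hI, rfl⟩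
      rw [show Ideal.absNorm I = m from hI, Int.modEq_iff_dvd]
      omega
    · rintro ⟨a, ha, rfl⟩
      exact ha
  · convert hasSum_zero with a
    rw [if_neg]
    rintro rfl
    have := Int.modEq_iff_dvd.mp a.2
    omega

lemma two_mul_eq_X_mul :
    2 * (PowerSeries.mk fun m => if 8 ∣ m ∧ m ≠ 0 then OStar (m / 8) else 0) =
      PowerSeries.X * PowerSeries.mk fun m => if 8 ∣ m + 1 then (-1) ^ ((m + 1) / 8) *
        ({I : Ideal (𝓞 QSqrtTwo) | Ideal.absNorm I = m}.ncard : ℤ) else 0 := by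
  ext m
  rw [two_mul, map_add, PowerSeries.coeff_mk, ← two_mul]
  cases m with
  | zero => simp
  | succ m =>
    rw [PowerSeries.coeff_succ_X_mul, PowerSeries.coeff_mk]
    by_cases h : 8 ∣ m + 1
    · rw [if_pos ⟨h, m.succ_ne_zero⟩, if_pos h]
      obtain ⟨d, hd⟩ := h
      have hset : {I : Ideal (𝓞 QSqrtTwo) | Ideal.absNorm I = m} =
          {I : Ideal (𝓞 QSqrtTwo) | (Ideal.absNorm I : ℤ) = 8 * d - 1} := by
        ext I
        simp only [Set.mem_ofPred_eq]
        omega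
      rw [hset, QSqrtTwo.ncard_setOf_absNorm_eq, hd, Nat.mul_div_cancel_left _ (by norm_num),
        OStar_eq_card]
      push_cast
      ring
    · rw [if_neg (fun h' => h h'.1), if_neg h, mul_zero]

/-- An identity of formal Laurent series in `q` with integer coefficients. The two infinite sums
are taken in `ℤ⟦q⟧` with its coefficientwise topology (`ℤ` being discrete), and both converge. -/
theorem corollary3p6 :
    Summable (fun n : ℕ+ => PowerSeries.C (OStar n) * (PowerSeries.X : ℤ⟦X⟧) ^ (8 * (n : ℕ))) ∧
    Summable (fun a : NormNegOneIdeal =>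
      (-1) ^ ((Ideal.absNorm a.1 + 1) / 8) * (PowerSeries.X : ℤ⟦X⟧) ^ Ideal.absNorm a.1) ∧
    2 * HahnSeries.single (-1 : ℤ) (1 : ℤ) *
        ((∑' n : ℕ+, PowerSeries.C (OStar n) * (PowerSeries.X : ℤ⟦X⟧) ^ (8 * (n : ℕ)) : ℤ⟦X⟧) :
          ℤ⸨X⸩) =
      ((∑' a : NormNegOneIdeal,
        (-1) ^ ((Ideal.absNorm a.1 + 1) / 8) * (PowerSeries.X : ℤ⟦X⟧) ^ Ideal.absNorm a.1 :
          ℤ⟦X⟧) : ℤ⸨X⸩) := by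
  refine ⟨hasSum_OStar.summable, hasSum_absNorm.summable, ?_⟩
  rw [hasSum_OStar.tsum_eq, hasSum_absNorm.tsum_eq]
  have h := congrArg (HahnSeries.ofPowerSeries ℤ ℤ) two_mul_eq_X_mul
  rw [map_mul, map_mul, map_ofNat, HahnSeries.ofPowerSeries_X] at h
  rw [mul_comm 2, mul_assoc, h, ← mul_assoc, HahnSeries.single_mul_single]
  simp
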